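/- Let $\mathbb{H}^1$ be the first Heisenberg group, i.e. $\mathbb{R}^3$ with the group law $(x,y,t)(x',y',t')=(x+x',\,y+y',\,t+t'-2(xy'-yx'))$. Let $d_e$ be the Euclidean distance on $\mathbb{R}^3$, and let $d_c$ be the Carnot–Carathéodory (CC) distance: $d_c(p,q)$ is the infimum of $\int_0^1|u(s)|\,ds$ over all absolutely continuous curves $\gamma\colon[0,1]\to\mathbb{R}^3$ from $p$ to $q$ and all $u=(u_1,u_2)\in L^1([0,1];\mathbb{R}^2)$ with $\gamma'=u_1X(\gamma)+u_2Y(\gamma)$ almost everywhere, where $X=\partial_x+2y\,\partial_t$ and $Y=\partial_y-2x\,\partial_t$. For a distance $d$ on a set $M$, a set $E\subset M$ and $\lambda\in(0,1)$, say that $E$ is $\lambda$-porous at $a$ if there are points $x_n\in M\setminus\{a\}$ with $d(x_n,a)\to 0$ and $\{y\in M: d(x_n,y)<\lambda d(x_n,a)\}\cap E=\varnothing$ for every $n$. The set $E$ is porous at $a$ if it is $\lambda$-porous at $a$ for some $\lambda\in(0,1)$, and $E$ is porous if there is one $\lambda\in(0,1)$ such that $E$ is $\lambda$-porous at every $a\in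 E$. Let $C\subset[0,1]$ be the middle third Cantor set and $A_{n,k}=(2^{-n}+k2^{-2n})+2^{-2n}C$. Define $$\Upsilon=\{(x,y,t)\in\mathbb{H}^1:\ |t|\ge 2|(x,y)|^2\},$$ $$P_c=\Upsilon\cap\Big(\{0\}\cup\bigcup_{n=1}^{\infty}\bigcup_{k=0}^{2^n-1}\{(x,y,t)\in\mathbb{H}^1:\ |(x,y)|\in A_{n,k}\}\Big),$$ where $|(x,y)|=\sqrt{x^2+y^2}$. Then $P_c$ is porous with respect to $d_c$, but $P_c$ is not porous at the point $0$ with respect to $d_e$. Moreover, CC porosity and Euclidean porosity are incomparable in $\mathbb{H}^1$: there is a subset of $\mathbb{H}^1$ which is porous with respect to $d_c$ but not with respect to $d_e$, and there is a subset of $\mathbb{H}^1$ which is porous with respect to $d_e$ but not with respect to $d_c$. -/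

import Mathlib

open Set Filter Topology MeasureTheory
open scoped ENNReal

/-- `E` is `lam`-porous at `a` for the distance `d`: there are points `x n`, different from `a` and
converging to `a`, such that the open ball of centre `x n` and radius `lam * d (x n) a` misses `E`.
The distance takes values in `[0, ∞]`. -/
def IsPorousAtWith {M : Type*} (d : M → M → ℝ≥0∞) (E : Set M) (lam : ℝ) (a : M) : Prop :=
  ∃ x : ℕ → M, (∀ n, x n ≠ a) ∧ Tendsto (fun n => d (x n) a) atTop (𝓝 0) ∧
    ∀ n, {y | d (x n) y < ENNReal.ofReal lam * d (x n) a} ∩ E = ∅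

/-- `E` is porous at `a`: it is `lam`-porous at `a` for some `lam` in `(0, 1)`. -/
def IsPorousAt {M : Type*} (d : M → M → ℝ≥0∞) (E : Set M) (a : M) : Prop :=
  ∃ lam ∈ Ioo (0 : ℝ) 1, IsPorousAtWith d E lam a

/-- `E` is porous: some `lam` in `(0, 1)` works at all points of `E`. -/
def IsPorous {M : Type*} (d : M → M → ℝ≥0∞) (E : Set M) : Prop :=
  ∃ lam ∈ Ioo (0 : ℝ) 1, ∀ a ∈ E, IsPorousAtWith d E lam a

namespace Heisenberg

/-- The underlying space `ℝ³` of the first Heisenberg group, with coordinates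
`(x, y, t) = (p 0, p 1, p 2)`. Its `edist` is the Euclidean distance. -/
abbrev H1 : Type := EuclideanSpace ℝ (Fin 3)

/-- The group law
`(x, y, t) (x', y', t') = (x + x', y + y', t + t' - 2 (x y' - y x'))`. -/
noncomputable def groupMul (p q : H1) : H1 :=
  !₂[p 0 + q 0, p 1 + q 1, p 2 + q 2 - 2 * (p 0 * q 1 - p 1 * q 0)]

/-- The left-invariant vector field `X = ∂x + 2 y ∂t`. -/
noncomputable def fieldX (p : H1) : H1 := !₂[1, 0, 2 * p 1]

/-- The left-invariant vector field `Y = ∂y - 2 x ∂t`. -/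
noncomputable def fieldY (p : H1) : H1 := !₂[0, 1, -(2 * p 0)]

/-- `X` is the left-invariant vector field which equals `∂x` at the identity. -/
theorem hasDerivAt_groupMul_fieldX (p : H1) :
    HasDerivAt (fun s : ℝ => groupMul p !₂[s, 0, 0]) (fieldX p) 0 := by
  have h : (fun s : ℝ => groupMul p !₂[s, 0, 0]) = fun s => p + s • fieldX p := by
    funext s
    ext i
    fin_cases i <;> simp [groupMul, fieldX] <;> ring
  rw [h]
  simpa using ((hasDerivAt_id (0 : ℝ)).smul_const (fieldX p)).const_add p

/-- `Y` is the left-invariant vector field which equals `∂y` at the identity. -/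
theorem hasDerivAt_groupMul_fieldY (p : H1) :
    HasDerivAt (fun s : ℝ => groupMul p !₂[0, s, 0]) (fieldY p) 0 := by
  have h : (fun s : ℝ => groupMul p !₂[0, s, 0]) = fun s => p + s • fieldY p := by
    funext s
    ext i
    fin_cases i <;> simp [groupMul, fieldY] <;> ring
  rw [h]
  simpa using ((hasDerivAt_id (0 : ℝ)).smul_const (fieldY p)).const_add p

/-- The curve `g : [0, 1] → ℍ¹` is horizontal, with control `u ∈ L¹([0, 1]; ℝ²)`: it is absolutely
continuous and `g' = u₁ X(g) + u₂ Y(g)` almost everywhere on `[0, 1]`. -/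
def IsHorizontal (g : ℝ → H1) (u : ℝ → EuclideanSpace ℝ (Fin 2)) : Prop :=
  AbsolutelyContinuousOnInterval g 0 1 ∧
    IntegrableOn u (Icc 0 1) ∧
    ∀ᵐ s ∂(volume.restrict (Icc (0 : ℝ) 1)),
      HasDerivAt g (u s 0 • fieldX (g s) + u s 1 • fieldY (g s)) s

/-- The Carnot-Carathéodory distance: the infimum of the horizontal lengths `∫₀¹ |u(s)| ds` of the
horizontal curves `g : [0, 1] → ℍ¹` joining `p` to `q`. -/
noncomputable def ccDist (p q : H1) : ℝ≥0∞ :=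
  sInf {L | ∃ (g : ℝ → H1) (u : ℝ → EuclideanSpace ℝ (Fin 2)),
    IsHorizontal g u ∧ g 0 = p ∧ g 1 = q ∧ L = ∫⁻ s in Icc (0 : ℝ) 1, ‖u s‖ₑ}

/-- The Euclidean norm `|(x, y)|` of the horizontal part of `(x, y, t)`. -/
noncomputable def horNorm (p : H1) : ℝ := √(p 0 ^ 2 + p 1 ^ 2)

/-- The translated and dilated Cantor set
`A_{n,k} = (2⁻ⁿ + k 2⁻²ⁿ) + 2⁻²ⁿ C`, where `C` is the middle third Cantor set. -/
def cantorPiece (n k : ℕ) : Set ℝ :=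
  (fun c : ℝ => (1 / 2 ^ n + k * (1 / 2 ^ (2 * n))) + 1 / 2 ^ (2 * n) * c) '' cantorSet

/-- The cusp `Υ = {(x, y, t) : |t| ≥ 2 |(x, y)|²}`. -/
def cusp : Set H1 := {p | |p 2| ≥ 2 * horNorm p ^ 2}

/-- The set `P_c`: the points of the cusp which are `0` or have `|(x, y)| ∈ A_{n,k}` for some
`n ≥ 1` and `0 ≤ k ≤ 2ⁿ - 1`. -/
def cuspShells : Set H1 :=
  cusp ∩ ({0} ∪ ⋃ (n : ℕ) (_ : 1 ≤ n) (k : ℕ) (_ : k < 2 ^ n), {p | horNorm p ∈ cantorPiece n k})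

end Heisenberg

/-! Off the origin both example sets are porous for both distances: on radial segments each distance
is at most the length, `horNorm` is 1-Lipschitz for each, and the shell radii have Cantor gaps
(`isPorousAtWith_of_horNorm_mem`). Everything is decided at the origin, where the radii leave gaps
only of size O(w²) near w (`exists_mem_shellRadii`).

A CC ball of radius comparable to r, at distance r from 0, has height O(r²) (`bounds_of_ccDist_lt`).
Hence CC balls about (r, 0, 0) miss the cusp |t| ≥ 2|(x,y)|², while a Euclidean move of size O(ρ²)
takes any point of norm ρ into the cusp and onto a shell.

For the converse the cusp is replaced by the region |t| ≤ |(x,y)|. Euclidean balls about (0, 0, r)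
miss it, but a point at CC distance δ from 0 has |t| = O(δ²), so a radial move of size O(δ²) reaches
the region and a shell. -/

/-! ### Gaps of the Cantor set -/

/-- Near each point of the Cantor set there is a gap of comparable size, inside `(0, 1)`. -/
theorem exists_gap_cantorSet (n : ℕ) : ∀ x ∈ cantorSet, ∃ s, s ≠ x ∧ |s - x| ≤ (1 / 3) ^ n ∧
    ∀ y, |y - s| < |s - x| / 4 → 0 < y ∧ y < 1 ∧ y ∉ cantorSet := by
  induction n with
  | zero =>
    intro x hx
    have h01 := cantorSet_subset_unitInterval hx
    have mid : ∀ y ∈ cantorSet, y ≤ 1 / 3 ∨ 2 / 3 ≤ y := by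
      intro y hy
      rw [cantorSet_eq_union_halves] at hy
      rcases hy with ⟨z, hz, rfl⟩ | ⟨z, hz, rfl⟩
      · have := (cantorSet_subset_unitInterval hz).2
        left; simp only; linarith
      · have := (cantorSet_subset_unitInterval hz).1
        right; simp only; linarith
    -- A quarter of this distance is at most 1/8, less than the half-width 1/6 of the gap (1/3,
    -- 2/3).
    have hle : |1 / 2 - x| ≤ 1 / 2 := by
      rw [abs_le]; constructor <;> linarith [h01.1, h01.2]
    refine ⟨1 / 2, ?_, by simpa using hle.trans (by norm_num), fun y hy => ?_⟩
    · rintro rfl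
      rcases mid _ hx with h | h <;> norm_num at h
    · have hy' : |y - 1 / 2| < 1 / 8 := by linarith
      rw [abs_lt] at hy'
      refine ⟨by linarith, by linarith, fun hyC => ?_⟩
      rcases mid _ hyC with h | h <;> linarith
  | succ n ih =>
    have third : ∀ x c : ℝ, ∀ s, |(c + s) / 3 - (c + x) / 3| = |s - x| / 3 := by
      intro x c s
      rw [← sub_div, abs_div, add_sub_add_left_eq_sub, abs_of_pos (by norm_num : (0 : ℝ) < 3)]
    -- Transport along z ↦ (c + z) / 3. Since the old gap lies in (0, 1), its image stays in one
    -- third and cannot meet the other half of the Cantor set.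
    have step : ∀ c : ℝ, (c = 0 ∨ c = 2) → ∀ x ∈ cantorSet, ∃ s, s ≠ (c + x) / 3 ∧
        |s - (c + x) / 3| ≤ (1 / 3) ^ (n + 1) ∧
        ∀ y, |y - s| < |s - (c + x) / 3| / 4 → 0 < y ∧ y < 1 ∧ y ∉ cantorSet := by
      intro c hc x hx
      obtain ⟨s, hne, hle, hgap⟩ := ih x hx
      refine ⟨(c + s) / 3, fun h => hne (by linarith), ?_, fun y hy => ?_⟩
      · rw [third, pow_succ]; linarith
      · have hy3 : y = (c + (3 * y - c)) / 3 := by ring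
        rw [third, hy3, third] at hy
        obtain ⟨h0, h1, h2⟩ := hgap (3 * y - c) (by linarith)
        refine ⟨by rcases hc with rfl | rfl <;> linarith,
          by rcases hc with rfl | rfl <;> linarith, fun hyC => ?_⟩
        rw [cantorSet_eq_union_halves] at hyC
        rcases hyC with ⟨z, hz, rfl⟩ | ⟨z, hz, rfl⟩ <;>
          have hz01 := cantorSet_subset_unitInterval hz <;> rcases hc with rfl | rfl <;>
          simp only at h0 h1 h2
        · exact h2 (by convert hz using 1; ring)
        · linarith [hz01.2]
        · linarith [hz01.1]
        · exact h2 (by convert hz using 1; ring)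
    intro x hx
    rw [cantorSet_eq_union_halves] at hx
    rcases hx with ⟨z, hz, rfl⟩ | ⟨z, hz, rfl⟩
    · simpa using step 0 (Or.inl rfl) z hz
    · exact step 2 (Or.inr rfl) z hz

/-! ### Shell radii: gaps, and density at 0 -/

namespace Heisenberg

/-- The radii of the shells: the union of the sets `A_{n,k}` for `n ≥ 1` and `k < 2 ^ n`. -/
def shellRadii : Set ℝ := ⋃ (n : ℕ) (_ : 1 ≤ n) (k : ℕ) (_ : k < 2 ^ n), cantorPiece n k

theorem mem_shellRadii {r : ℝ} : r ∈ shellRadii ↔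
    ∃ n k : ℕ, 1 ≤ n ∧ k < 2 ^ n ∧ r ∈ cantorPiece n k := by
  simp only [shellRadii, mem_iUnion, exists_prop]
  exact ⟨fun ⟨n, hn, k, h⟩ => ⟨n, k, hn, h⟩, fun ⟨n, k, hn, h⟩ => ⟨n, hn, k, h⟩⟩

theorem cantorPiece_subset (n k : ℕ) : cantorPiece n k ⊆
    Icc (1 / 2 ^ n + k * (1 / 2 ^ (2 * n))) (1 / 2 ^ n + (k + 1) * (1 / 2 ^ (2 * n))) := by
  rintro _ ⟨c, hc, rfl⟩
  obtain ⟨h0, h1⟩ := cantorSet_subset_unitInterval hc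
  have hb : (0 : ℝ) < 1 / 2 ^ (2 * n) := by positivity
  constructor <;> simp only <;> nlinarith

/-- The 2ⁿ intervals of level n, each of length 2⁻²ⁿ, fill [2⁻ⁿ, 2·2⁻ⁿ], so distinct levels have
disjoint interiors. -/
theorem add_mul_le_of_lt {n k : ℕ} (hk : k < 2 ^ n) :
    (1 : ℝ) / 2 ^ n + (k + 1) * (1 / 2 ^ (2 * n)) ≤ 2 * (1 / 2 ^ n) := by
  have hk' : (k : ℝ) + 1 ≤ 2 ^ n := by exact_mod_cast hk
  have h : (1 : ℝ) / 2 ^ n = 2 ^ n * (1 / 2 ^ (2 * n)) := by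
    rw [two_mul, pow_add]; field_simp
  have hb : (0 : ℝ) < 1 / 2 ^ (2 * n) := by positivity
  nlinarith

theorem two_mul_one_div_two_pow_le {m n : ℕ} (h : m < n) : 2 * ((1 : ℝ) / 2 ^ n) ≤ 1 / 2 ^ m := by
  have : (1 : ℝ) / 2 ^ n ≤ 1 / 2 ^ (m + 1) :=
    one_div_le_one_div_of_le (by positivity) (pow_le_pow_right₀ (by norm_num) h)
  calc 2 * ((1 : ℝ) / 2 ^ n) ≤ 2 * (1 / 2 ^ (m + 1)) := by linarith
    _ = 1 / 2 ^ m := by rw [pow_succ]; field_simp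

/-- The interiors of the intervals which carry the sets `A_{n,k}` meet no other such interval. -/
theorem eq_of_mem_cantorPiece {n k m l : ℕ} (hk : k < 2 ^ n) (hl : l < 2 ^ m) {y : ℝ}
    (hy : y ∈ Ioo ((1 : ℝ) / 2 ^ n + k * (1 / 2 ^ (2 * n)))
      (1 / 2 ^ n + (k + 1) * (1 / 2 ^ (2 * n))))
    (hy' : y ∈ cantorPiece m l) : m = n ∧ l = k := by
  obtain ⟨h1, h2⟩ := cantorPiece_subset m l hy'
  have hn := add_mul_le_of_lt hk
  have hm := add_mul_le_of_lt hl
  have hbn : (0 : ℝ) < 1 / 2 ^ (2 * n) := by positivity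
  have hbm : (0 : ℝ) < 1 / 2 ^ (2 * m) := by positivity
  have hkn : 0 ≤ (k : ℝ) * (1 / 2 ^ (2 * n)) := by positivity
  have hlm : 0 ≤ (l : ℝ) * (1 / 2 ^ (2 * m)) := by positivity
  rcases lt_trichotomy m n with h | rfl | h
  · have := two_mul_one_div_two_pow_le h
    linarith [hy.2]
  · refine ⟨rfl, ?_⟩
    have e1 : (k : ℝ) < l + 1 := lt_of_mul_lt_mul_right (by linarith [hy.1]) hbm.le
    have e2 : (l : ℝ) < k + 1 := lt_of_mul_lt_mul_right (by linarith [hy.2]) hbm.le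
    norm_cast at e1 e2
    omega
  · have := two_mul_one_div_two_pow_le h
    linarith [hy.1]

theorem pos_of_mem_shellRadii {r : ℝ} (hr : r ∈ shellRadii) : 0 < r := by
  obtain ⟨n, k, -, -, h⟩ := mem_shellRadii.1 hr
  exact lt_of_lt_of_le (by positivity) (cantorPiece_subset n k h).1

/-- Near each shell radius there is a gap of comparable size in the set of shell radii. -/
theorem exists_gap_shellRadii {r : ℝ} (hr : r ∈ shellRadii) {ε : ℝ} (hε : 0 < ε) :
    ∃ s, 0 < s ∧ s ≠ r ∧ |s - r| < ε ∧ ∀ y, |y - s| < |s - r| / 4 → y ∉ shellRadii := by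
  obtain ⟨n, k, hn, hk, c, hc, rfl⟩ := mem_shellRadii.1 hr
  obtain ⟨j, hj⟩ := exists_pow_lt_of_lt_one hε (by norm_num : (1 / 3 : ℝ) < 1)
  obtain ⟨s, hne, hle, hgap⟩ := exists_gap_cantorSet j c hc
  set b : ℝ := 1 / 2 ^ (2 * n) with hb
  set a : ℝ := 1 / 2 ^ n + k * b with ha
  have hb0 : 0 < b := by positivity
  have ha0 : 0 < a := by positivity
  have hb1 : b ≤ 1 := by
    rw [hb, div_le_one (by positivity)]; exact one_le_pow₀ (by norm_num)
  have scale : ∀ u v : ℝ, |(a + b * u) - (a + b * v)| = b * |u - v| := by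
    intro u v
    rw [add_sub_add_left_eq_sub, ← mul_sub, abs_mul, abs_of_pos hb0]
  have hs0 : 0 < s := (hgap s (by simpa using sub_ne_zero.2 hne)).1
  refine ⟨a + b * s, by positivity, fun h => hne (by simpa [hb0.ne'] using h), ?_,
    fun y hy hyS => ?_⟩
  · rw [scale]
    calc b * |s - c| ≤ 1 * |s - c| := by gcongr
      _ < ε := by linarith
  · have hy' : y = a + b * ((y - a) / b) := by field_simp; ring
    rw [hy', scale, scale] at hy
    obtain ⟨h0, h1, h2⟩ := hgap ((y - a) / b) (by
      refine lt_of_mul_lt_mul_left ?_ hb0.le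
      linarith)
    rw [div_lt_one hb0] at h1
    have h0' : 0 < y - a := by
      by_contra h
      exact absurd h0 (not_lt.2 (div_nonpos_of_nonpos_of_nonneg (not_lt.1 h) hb0.le))
    obtain ⟨m, l, -, hl, hml⟩ := mem_shellRadii.1 hyS
    obtain ⟨rfl, rfl⟩ := eq_of_mem_cantorPiece hk hl ⟨by linarith, by rw [add_mul]; linarith⟩ hml
    obtain ⟨z, hz, hzy⟩ := hml
    refine h2 ?_
    convert hz using 1
    rw [div_eq_iff hb0.ne', ← hzy]
    ring

/-- The shell radii are dense near `0`, at a scale quadratic in the distance to `0`. -/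
theorem exists_mem_shellRadii {w : ℝ} (h0 : 0 < w) (h1 : w < 1) :
    ∃ s ∈ shellRadii, w - w ^ 2 ≤ s ∧ s ≤ w := by
  obtain ⟨n, hn, hn1, hnw⟩ : ∃ n : ℕ, 1 ≤ n ∧ (1 : ℝ) / 2 ^ n ≤ w ∧ w < 2 * (1 / 2 ^ n) := by
    obtain ⟨m, hm, hm'⟩ := exists_nat_pow_near (one_le_inv_iff₀.2 ⟨h0, h1.le⟩)
      (by norm_num : (1 : ℝ) < 2)
    -- The upper bound on w must be strict, so an exact power w = 2⁻ᵐ takes n = m and all other w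
    -- take n = m + 1.
    rcases eq_or_lt_of_le hm with h | h
    · refine ⟨m, ?_, ?_, ?_⟩
      · rcases Nat.eq_zero_or_pos m with rfl | hm0
        · rw [pow_zero, eq_comm, inv_eq_one] at h
          exact absurd h h1.ne
        · exact hm0
      · rw [h]; simp
      · rw [h]; simp only [one_div, inv_inv]; linarith
    · refine ⟨m + 1, by omega, ?_, ?_⟩
      · rw [one_div]; exact (inv_lt_of_inv_lt₀ h0 hm').le
      · have := lt_inv_of_lt_inv₀ (by positivity) h
        rwa [pow_succ, show 2 * (1 / ((2 : ℝ) ^ m * 2)) = (2 ^ m)⁻¹ by field_simp]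
  set b : ℝ := 1 / 2 ^ (2 * n) with hb
  have hb0 : 0 < b := by positivity
  have hbb : b = (1 / 2 ^ n) ^ 2 := by rw [hb, div_pow, one_pow, ← pow_mul, mul_comm]
  have hq : 0 ≤ (w - 1 / 2 ^ n) / b := div_nonneg (by linarith) hb0.le
  set k := ⌊(w - 1 / 2 ^ n) / b⌋₊ with hkdef
  have hk1 : (k : ℝ) * b ≤ w - 1 / 2 ^ n := (le_div_iff₀ hb0).1 (Nat.floor_le hq)
  have hk2 : w - 1 / 2 ^ n < (k + 1) * b := (div_lt_iff₀ hb0).1 (Nat.lt_floor_add_one _)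
  have hk : k < 2 ^ n := by
    have h : (k : ℝ) < 2 ^ n := by
      refine lt_of_mul_lt_mul_right (a := b) ?_ hb0.le
      have : (2 : ℝ) ^ n * b = 1 / 2 ^ n := by rw [hbb]; field_simp
      linarith
    exact_mod_cast h
  -- The left endpoint of the interval containing w; its length b = (2⁻ⁿ)² is at most w².
  refine ⟨1 / 2 ^ n + k * b, mem_shellRadii.2 ⟨n, k, hn, hk, 0, zero_mem_cantorSet, ?_⟩, ?_, ?_⟩
  · simp [hb]
  · have : b ≤ w ^ 2 := by rw [hbb]; gcongr
    linarith
  · linarith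

end Heisenberg

/-! ### Estimates for the CC distance -/

theorem LipschitzWith.comp_absolutelyContinuousOnInterval {X Y : Type*} [PseudoMetricSpace X]
    [PseudoMetricSpace Y] {K : NNReal} {φ : X → Y} (hφ : LipschitzWith K φ) {f : ℝ → X} {a b : ℝ}
    (hf : AbsolutelyContinuousOnInterval f a b) :
    AbsolutelyContinuousOnInterval (fun s => φ (f s)) a b := by
  rw [absolutelyContinuousOnInterval_iff] at hf ⊢
  intro ε hε
  obtain ⟨δ, hδ, h⟩ := hf (ε / (K + 1)) (by positivity)
  refine ⟨δ, hδ, fun E hE hEδ => ?_⟩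
  have h1 := h E hE hEδ
  rw [lt_div_iff₀ (by positivity)] at h1
  refine lt_of_le_of_lt ?_ h1
  rw [Finset.sum_mul]
  refine Finset.sum_le_sum fun i _ => (hφ.dist_le_mul _ _).trans ?_
  rw [mul_comm]
  gcongr
  simp

namespace Heisenberg

/-- The point with horizontal part `s (a, b)` and height `t`. -/
noncomputable def radialPoint (a b s t : ℝ) : H1 := !₂[s * a, s * b, t]

@[simp] theorem radialPoint_zero (a b s t : ℝ) : radialPoint a b s t 0 = s * a := rfl
@[simp] theorem radialPoint_one (a b s t : ℝ) : radialPoint a b s t 1 = s * b := rfl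
@[simp] theorem radialPoint_two (a b s t : ℝ) : radialPoint a b s t 2 = t := rfl

theorem horNorm_radialPoint {a b s t : ℝ} (hab : a ^ 2 + b ^ 2 = 1) (hs : 0 ≤ s) :
    horNorm (radialPoint a b s t) = s := by
  have : (s * a) ^ 2 + (s * b) ^ 2 = s ^ 2 := by linear_combination s ^ 2 * hab
  rw [horNorm, radialPoint_zero, radialPoint_one, this, Real.sqrt_sq hs]

theorem horNorm_eq_norm (p : H1) : horNorm p = ‖(⟨p 0, p 1⟩ : ℂ)‖ := by
  rw [Complex.norm_def, Complex.normSq_mk, horNorm, sq, sq]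

theorem horNorm_nonneg (p : H1) : 0 ≤ horNorm p := Real.sqrt_nonneg _

@[simp] theorem horNorm_zero : horNorm 0 = 0 := by simp [horNorm]

theorem sq_horNorm (p : H1) : horNorm p ^ 2 = p 0 ^ 2 + p 1 ^ 2 := Real.sq_sqrt (by positivity)

theorem abs_horNorm_sub_le (p q : H1) : |horNorm q - horNorm p| ≤ horNorm (q - p) := by
  simp only [horNorm_eq_norm]
  exact abs_norm_sub_norm_le _ _

theorem eq_zero_of_horNorm_eq_zero {p : H1} (h : horNorm p = 0) (h2 : p 2 = 0) : p = 0 := by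
  have h3 := sq_horNorm p
  rw [h] at h3
  have h0 : p 0 = 0 := by nlinarith [sq_nonneg (p 0), sq_nonneg (p 1)]
  have h1 : p 1 = 0 := by nlinarith [sq_nonneg (p 0), sq_nonneg (p 1)]
  ext i
  fin_cases i <;> assumption

theorem exists_eq_radialPoint (p : H1) :
    ∃ a b : ℝ, a ^ 2 + b ^ 2 = 1 ∧ p = radialPoint a b (horNorm p) (p 2) := by
  by_cases h : horNorm p = 0
  · have h3 := sq_horNorm p
    rw [h] at h3
    have h0 : p 0 = 0 := by nlinarith [sq_nonneg (p 0), sq_nonneg (p 1)]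
    have h1 : p 1 = 0 := by nlinarith [sq_nonneg (p 0), sq_nonneg (p 1)]
    refine ⟨1, 0, by norm_num, ?_⟩
    ext i
    fin_cases i <;> simp [radialPoint, h, h0, h1]
  · refine ⟨p 0 / horNorm p, p 1 / horNorm p, ?_, ?_⟩
    · rw [div_pow, div_pow, ← add_div, sq_horNorm, ← sq_horNorm]
      exact div_self (pow_ne_zero 2 h)
    · ext i
      fin_cases i <;> simp [radialPoint, mul_div_cancel₀, h]

/-- Radial segments are horizontal, so the Carnot-Carathéodory distance of their endpoints is at
most their length. -/
theorem ccDist_radialPoint_le {a b : ℝ} (hab : a ^ 2 + b ^ 2 = 1) (s r t : ℝ) :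
    ccDist (radialPoint a b s t) (radialPoint a b r t) ≤ ENNReal.ofReal |s - r| := by
  set v : H1 := radialPoint a b (r - s) 0 with hv
  set u : EuclideanSpace ℝ (Fin 2) := !₂[(r - s) * a, (r - s) * b] with hu
  have hnorm : ‖u‖ = |s - r| := by
    rw [EuclideanSpace.norm_eq, abs_sub_comm, ← Real.sqrt_sq_eq_abs]
    congr 1
    simp only [hu, Fin.sum_univ_two, Real.norm_eq_abs, sq_abs]
    simp
    linear_combination (r - s) ^ 2 * hab
  have hd : ∀ τ : ℝ, HasDerivAt (fun τ : ℝ => radialPoint a b s t + τ • v) v τ := fun τ => by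
    simpa using ((hasDerivAt_id τ).smul_const v).const_add (radialPoint a b s t)
  refine sInf_le ⟨fun τ => radialPoint a b s t + τ • v, fun _ => u, ⟨?_, ?_, ?_⟩, ?_, ?_, ?_⟩
  · refine LipschitzOnWith.absolutelyContinuousOnInterval (K := ‖v‖₊)
      (LipschitzWith.lipschitzOnWith (LipschitzWith.of_dist_le_mul fun x y => ?_))
    rw [dist_add_left, dist_eq_norm, ← sub_smul, norm_smul, mul_comm, dist_eq_norm, coe_nnnorm]
  · exact integrableOn_const (by simp)
  · refine ae_of_all _ fun τ => ?_
    convert hd τ using 1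
    ext i
    fin_cases i <;> simp [hu, hv, fieldX, fieldY]
    ring
  · simp
  · ext i
    fin_cases i <;> simp [hv] <;> ring
  · rw [setLIntegral_const, Real.volume_Icc, sub_zero, ENNReal.ofReal_one, mul_one,
      ← ofReal_norm, hnorm]

/-- A linear functional along a horizontal curve grows at most as fast as the length, up to a bound
of its values on the horizontal directions. -/
theorem IsHorizontal.abs_sub_le {g : ℝ → H1} {u : ℝ → EuclideanSpace ℝ (Fin 2)}
    (h : IsHorizontal g u) (φ : H1 →L[ℝ] ℝ) {K τ : ℝ} (hτ : τ ∈ Icc (0 : ℝ) 1) (hK : 0 ≤ K)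
    (hφ : ∀ s ∈ Icc (0 : ℝ) 1,
      |φ (u s 0 • fieldX (g s) + u s 1 • fieldY (g s))| ≤ K * ‖u s‖) :
    |φ (g τ) - φ (g 0)| ≤ K * ∫ s in Icc (0 : ℝ) 1, ‖u s‖ := by
  obtain ⟨hac, hint, hder⟩ := h
  have hsub : Ioc 0 τ ⊆ Icc (0 : ℝ) 1 := fun s hs => ⟨hs.1.le, hs.2.trans hτ.2⟩
  have hac' : AbsolutelyContinuousOnInterval (fun s => φ (g s)) 0 τ :=
    (φ.lipschitz.comp_absolutelyContinuousOnInterval hac).mono (by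
      rw [uIcc_of_le hτ.1, uIcc_of_le zero_le_one]
      exact Icc_subset_Icc_right hτ.2)
  rw [← hac'.integral_deriv_eq_sub, ← Real.norm_eq_abs]
  rw [ae_restrict_iff' measurableSet_Icc] at hder
  have hintK : IntegrableOn (fun s => K * ‖u s‖) (Icc 0 1) := hint.norm.const_mul K
  refine (intervalIntegral.norm_integral_le_of_norm_le hτ.1 (g := fun s => K * ‖u s‖) ?_ ?_).trans ?_
  · filter_upwards [hder] with s hs hsτ
    have hd : HasDerivAt (fun s => φ (g s)) _ s := φ.hasFDerivAt.comp_hasDerivAt s (hs (hsub hsτ))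
    rw [hd.deriv]
    exact hφ s (hsub hsτ)
  · exact (intervalIntegrable_iff_integrableOn_Ioc_of_le hτ.1).2 (hintK.mono_set hsub)
  · rw [intervalIntegral.integral_of_le hτ.1, ← integral_const_mul]
    exact setIntegral_mono_set hintK (ae_of_all _ fun s => by positivity) hsub.eventuallyLE

theorem abs_mul_add_mul_le (a b : ℝ) (u : EuclideanSpace ℝ (Fin 2)) :
    |a * u 0 + b * u 1| ≤ √(a ^ 2 + b ^ 2) * ‖u‖ := by
  rw [EuclideanSpace.norm_eq, ← Real.sqrt_mul (by positivity)]
  refine Real.abs_le_sqrt ?_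
  simp only [Fin.sum_univ_two, Real.norm_eq_abs, sq_abs]
  nlinarith [sq_nonneg (a * u 1 - b * u 0)]

/-- Test against the linear functional given by the horizontal displacement itself: this yields D² ≤
D·L without differentiating a norm. -/
theorem IsHorizontal.horNorm_sub_le {g : ℝ → H1} {u : ℝ → EuclideanSpace ℝ (Fin 2)}
    (h : IsHorizontal g u) {τ : ℝ} (hτ : τ ∈ Icc (0 : ℝ) 1) :
    horNorm (g τ - g 0) ≤ ∫ s in Icc (0 : ℝ) 1, ‖u s‖ := by
  set a := (g τ - g 0) 0 with ha
  set b := (g τ - g 0) 1 with hb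
  set L := ∫ s in Icc (0 : ℝ) 1, ‖u s‖
  have hL : 0 ≤ L := integral_nonneg fun s => norm_nonneg _
  have key := h.abs_sub_le (a • EuclideanSpace.proj (0 : Fin 3) + b • EuclideanSpace.proj (1 : Fin 3))
    hτ (K := √(a ^ 2 + b ^ 2)) (Real.sqrt_nonneg _) (fun s _ => by
      simpa [fieldX, fieldY] using abs_mul_add_mul_le a b (u s))
  have hD : √(a ^ 2 + b ^ 2) = horNorm (g τ - g 0) := rfl
  rw [← map_sub, hD] at key
  have e : (a • EuclideanSpace.proj (0 : Fin 3) + b • EuclideanSpace.proj (1 : Fin 3) : H1 →L[ℝ] ℝ)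
      (g τ - g 0) = horNorm (g τ - g 0) ^ 2 := by
    rw [sq_horNorm]
    change a * a + b * b = a ^ 2 + b ^ 2
    ring
  rw [e, abs_of_nonneg (by positivity), sq] at key
  rcases (horNorm_nonneg (g τ - g 0)).eq_or_lt with h0 | h0
  · rwa [← h0]
  · exact le_of_mul_le_mul_left key h0

theorem horNorm_le_add (p q : H1) : horNorm q ≤ horNorm p + horNorm (q - p) := by
  linarith [(abs_le.1 (abs_horNorm_sub_le p q)).2]

/-- Along the curve t' = 2(y u₁ - x u₂), so |t'| ≤ 2|(x,y)||u|, and |(x,y)| exceeds its initial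
value by at most L. -/
theorem IsHorizontal.abs_two_sub_le {g : ℝ → H1} {u : ℝ → EuclideanSpace ℝ (Fin 2)}
    (h : IsHorizontal g u) {L : ℝ} (hL : ∫ s in Icc (0 : ℝ) 1, ‖u s‖ = L) :
    |g 1 2 - g 0 2| ≤ 2 * (horNorm (g 0) + L) * L := by
  have hL0 : 0 ≤ L := hL ▸ integral_nonneg fun s => norm_nonneg _
  have hK : 0 ≤ 2 * (horNorm (g 0) + L) := by linarith [horNorm_nonneg (g 0)]
  have key := h.abs_sub_le (EuclideanSpace.proj (2 : Fin 3)) (right_mem_Icc.2 zero_le_one) hK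
    (fun s hs => by
      have h1 := abs_mul_add_mul_le (2 * g s 1) (-(2 * g s 0)) (u s)
      have h2 : √((2 * g s 1) ^ 2 + (-(2 * g s 0)) ^ 2) = 2 * horNorm (g s) := by
        rw [Real.sqrt_eq_iff_mul_self_eq (by positivity) (by linarith [horNorm_nonneg (g s)])]
        linear_combination -4 * sq_horNorm (g s)
      have h3 : horNorm (g s) ≤ horNorm (g 0) + L :=
        (horNorm_le_add (g 0) (g s)).trans (by linarith [h.horNorm_sub_le hs])
      rw [h2] at h1
      have h4 : 2 * horNorm (g s) * ‖u s‖ ≤ 2 * (horNorm (g 0) + L) * ‖u s‖ := by gcongr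
      refine le_trans (le_of_eq ?_) (h1.trans h4)
      simp [fieldX, fieldY]
      ring_nf)
  rw [hL] at key
  exact key

/-- A Carnot-Carathéodory ball is contained in a cylinder over a Euclidean disc. -/
theorem bounds_of_ccDist_lt {p q : H1} {R : ℝ} (h : ccDist p q < ENNReal.ofReal R) :
    |horNorm q - horNorm p| < R ∧ |q 2 - p 2| ≤ 2 * (horNorm p + R) * R := by
  obtain ⟨_, ⟨g, u, hg, rfl, rfl, rfl⟩, hlt⟩ := sInf_lt_iff.1 h
  have hLR : ∫ s in Icc (0 : ℝ) 1, ‖u s‖ < R := by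
    rw [integral_norm_eq_lintegral_enorm hg.2.1.aestronglyMeasurable]
    exact ENNReal.toReal_lt_of_lt_ofReal hlt
  have hL0 : 0 ≤ ∫ s in Icc (0 : ℝ) 1, ‖u s‖ := integral_nonneg fun s => norm_nonneg _
  refine ⟨((abs_horNorm_sub_le _ _).trans
    (hg.horNorm_sub_le (right_mem_Icc.2 zero_le_one))).trans_lt hLR,
    (hg.abs_two_sub_le rfl).trans ?_⟩
  have h0 := horNorm_nonneg (g 0)
  have hR : 0 ≤ R := hL0.trans hLR.le
  gcongr

end Heisenberg

/-! ### Porosity and its failure at the origin -/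

namespace Heisenberg

theorem norm_sq_eq (p : H1) : ‖p‖ ^ 2 = horNorm p ^ 2 + p 2 ^ 2 := by
  rw [EuclideanSpace.norm_sq_eq, sq_horNorm]
  simp [Fin.sum_univ_three]

theorem horNorm_le_norm (p : H1) : horNorm p ≤ ‖p‖ :=
  abs_le_of_sq_le_sq' (by nlinarith [norm_sq_eq p]) (norm_nonneg p) |>.2

theorem abs_two_le_norm (p : H1) : |p 2| ≤ ‖p‖ :=
  abs_le_of_sq_le_sq (by nlinarith [norm_sq_eq p, sq_nonneg (horNorm p)]) (norm_nonneg p)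

theorem bounds_of_edist_lt {p q : H1} {R : ℝ} (h : edist p q < ENNReal.ofReal R) :
    |horNorm q - horNorm p| < R ∧ |q 2 - p 2| < R := by
  rw [edist_comm, edist_dist, dist_eq_norm] at h
  have h' : ‖q - p‖ < R := (ENNReal.ofReal_lt_ofReal_iff_of_nonneg (norm_nonneg _)).1 h
  exact ⟨((abs_horNorm_sub_le p q).trans (horNorm_le_norm _)).trans_lt h',
    (abs_two_le_norm (q - p)).trans_lt h'⟩

theorem dist_radialPoint_le {a b : ℝ} (hab : a ^ 2 + b ^ 2 = 1) (s r t t' : ℝ) :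
    dist (radialPoint a b s t) (radialPoint a b r t') ≤ |s - r| + |t - t'| := by
  rw [dist_eq_norm]
  refine abs_le_of_sq_le_sq' ?_ (by positivity) |>.2
  rw [norm_sq_eq, sq_horNorm]
  simp only [PiLp.sub_apply, radialPoint_zero, radialPoint_one, radialPoint_two]
  have : 0 ≤ |s - r| * |t - t'| := by positivity
  have e : (s * a - r * a) ^ 2 + (s * b - r * b) ^ 2 = |s - r| ^ 2 := by
    rw [sq_abs]; linear_combination (s - r) ^ 2 * hab
  rw [e, ← sq_abs (t - t')]
  nlinarith

theorem edist_radialPoint_le {a b : ℝ} (hab : a ^ 2 + b ^ 2 = 1) (s r t : ℝ) :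
    edist (radialPoint a b s t) (radialPoint a b r t) ≤ ENNReal.ofReal |s - r| := by
  rw [edist_dist]
  exact ENNReal.ofReal_le_ofReal (by simpa using dist_radialPoint_le hab s r t t)

/-- A union of shells is porous at its points off the vertical axis, for every distance which is
bounded by the length on radial segments and for which `horNorm` is a contraction. -/
theorem isPorousAtWith_of_horNorm_mem {d : H1 → H1 → ℝ≥0∞}
    (hrad : ∀ {a b : ℝ}, a ^ 2 + b ^ 2 = 1 → ∀ s r t : ℝ,
      d (radialPoint a b s t) (radialPoint a b r t) ≤ ENNReal.ofReal |s - r|)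
    (hlow : ∀ {p q : H1} {R : ℝ}, d p q < ENNReal.ofReal R → |horNorm q - horNorm p| < R)
    {E : Set H1} (hE : ∀ p ∈ E, p = 0 ∨ horNorm p ∈ shellRadii) {p : H1}
    (hp : horNorm p ∈ shellRadii) : IsPorousAtWith d E (1 / 4) p := by
  obtain ⟨a, b, hab, hpr⟩ := exists_eq_radialPoint p
  have hr := pos_of_mem_shellRadii hp
  -- The bound `horNorm p / 2` keeps the hole away from the origin, whose radius 0 is not a shell
  -- radius.
  have hex : ∀ n : ℕ, ∃ s, 0 < s ∧ s ≠ horNorm p ∧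
      |s - horNorm p| < min (1 / ((n : ℝ) + 1)) (horNorm p / 2) ∧
      ∀ y, |y - s| < |s - horNorm p| / 4 → y ∉ shellRadii := fun n =>
    exists_gap_shellRadii hp (lt_min (by positivity) (by positivity))
  choose s hs0 hsne hsε hgap using hex
  have hd : ∀ n, d (radialPoint a b (s n) (p 2)) p ≤ ENNReal.ofReal |s n - horNorm p| := fun n => by
    conv_lhs => rw [hpr]
    exact hrad hab _ _ _
  refine ⟨fun n => radialPoint a b (s n) (p 2), fun n h => hsne n ?_, ?_, fun n => ?_⟩
  · rw [← horNorm_radialPoint (t := p 2) hab (hs0 n).le]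
    exact congrArg horNorm h
  · have hlim : Tendsto (fun n : ℕ => ENNReal.ofReal (1 / ((n : ℝ) + 1))) atTop (𝓝 0) := by
      simpa using ENNReal.tendsto_ofReal tendsto_one_div_add_atTop_nhds_zero_nat
    exact tendsto_of_tendsto_of_tendsto_of_le_of_le tendsto_const_nhds hlim (fun n => zero_le)
      fun n => (hd n).trans (ENNReal.ofReal_le_ofReal ((hsε n).le.trans (min_le_left _ _)))
  · refine eq_empty_of_forall_notMem fun y ⟨hy, hyE⟩ => ?_
    have h1 : d (radialPoint a b (s n) (p 2)) y < ENNReal.ofReal (|s n - horNorm p| / 4) := by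
      refine lt_of_lt_of_le hy ((mul_le_mul_right (hd n) _).trans ?_)
      rw [← ENNReal.ofReal_mul (by norm_num)]
      exact ENNReal.ofReal_le_ofReal (by linarith)
    have h2 := hlow h1
    rw [horNorm_radialPoint hab (hs0 n).le] at h2
    rcases hE y hyE with rfl | h
    · have h3 := (hsε n).trans_le (min_le_right _ _)
      rw [horNorm_zero] at h2
      have h4 := (abs_lt.1 h2).1
      have h5 := (abs_lt.1 h3).1
      linarith
    · exact hgap n _ h2 h

theorem mem_cuspShells {p : H1} :
    p ∈ cuspShells ↔ 2 * horNorm p ^ 2 ≤ |p 2| ∧ (p = 0 ∨ horNorm p ∈ shellRadii) := by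
  simp [cuspShells, cusp, shellRadii]

theorem isPorousAtWith_zero_of_gap {d : H1 → H1 → ℝ≥0∞} {E : Set H1} (x : ℝ → H1)
    (hx : ∀ r, 0 < r → x r ≠ 0) (hd : ∀ r, 0 < r → d (x r) 0 ≤ ENNReal.ofReal r)
    (hgap : ∀ r, 0 < r → ∀ y, d (x r) y < ENNReal.ofReal (r / 4) → y ∉ E) :
    IsPorousAtWith d E (1 / 4) 0 := by
  have hpos : ∀ n : ℕ, 0 < 1 / ((n : ℝ) + 1) := fun n => by positivity
  refine ⟨fun n => x (1 / ((n : ℝ) + 1)), fun n => hx _ (hpos n), ?_, fun n => ?_⟩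
  · have hlim : Tendsto (fun n : ℕ => ENNReal.ofReal (1 / ((n : ℝ) + 1))) atTop (𝓝 0) := by
      simpa using ENNReal.tendsto_ofReal tendsto_one_div_add_atTop_nhds_zero_nat
    exact tendsto_of_tendsto_of_tendsto_of_le_of_le tendsto_const_nhds hlim (fun n => zero_le)
      fun n => hd _ (hpos n)
  · refine eq_empty_of_forall_notMem fun y ⟨hy, hyE⟩ => hgap _ (hpos n) y ?_ hyE
    refine lt_of_lt_of_le hy ((mul_le_mul_right (hd _ (hpos n)) _).trans ?_)
    rw [← ENNReal.ofReal_mul (by norm_num)]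
    exact ENNReal.ofReal_le_ofReal (by linarith)

theorem isPorous_ccDist_cuspShells : IsPorous ccDist cuspShells := by
  refine ⟨1 / 4, by norm_num, fun p hp => ?_⟩
  rcases (mem_cuspShells.1 hp).2 with rfl | hr
  · have hab : (1 : ℝ) ^ 2 + 0 ^ 2 = 1 := by norm_num
    refine isPorousAtWith_zero_of_gap (fun r => radialPoint 1 0 r 0) (fun r hr h => ?_)
      (fun r hr => ?_) (fun r hr y hy hyE => ?_)
    · have := congrArg horNorm h
      rw [horNorm_radialPoint hab hr.le, horNorm_zero] at this
      exact hr.ne' this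
    · have h0 : (0 : H1) = radialPoint 1 0 0 0 := by
        ext i; fin_cases i <;> simp [radialPoint]
      rw [h0]
      simpa [abs_of_pos hr] using ccDist_radialPoint_le hab r 0 0
    -- In this ball |t| ≤ 5r²/8, while 2|(x,y)|² > 2(3r/4)² = 9r²/8.
    · obtain ⟨h1, h2⟩ := bounds_of_ccDist_lt hy
      rw [horNorm_radialPoint hab hr.le] at h1 h2
      rw [radialPoint_two, sub_zero] at h2
      have h3 := (abs_lt.1 h1).1
      nlinarith [(mem_cuspShells.1 hyE).1]
  · exact isPorousAtWith_of_horNorm_mem ccDist_radialPoint_le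
      (fun h => (bounds_of_ccDist_lt h).1) (fun q hq => (mem_cuspShells.1 hq).2) hr

theorem not_isPorousAt_edist_cuspShells :
    ¬ IsPorousAt (fun p q : H1 => edist p q) cuspShells 0 := by
  rintro ⟨lam, ⟨hl0, hl1⟩, x, hne, hlim, hball⟩
  obtain ⟨n, hn⟩ := (hlim.eventually_lt_const
    (ENNReal.ofReal_pos.2 (by linarith : 0 < lam / 100))).exists
  set p := x n
  set ρ := ‖p‖
  have hρ0 : 0 < ρ := norm_pos_iff.2 (hne n)
  beta_reduce at hn
  rw [edist_dist, dist_zero_right, ENNReal.ofReal_lt_ofReal_iff (by linarith)] at hn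
  set z := horNorm p
  have hz0 : 0 ≤ z := horNorm_nonneg p
  have hzρ : z ≤ ρ := horNorm_le_norm p
  have hw2 : (z + ρ ^ 2) ≤ 2 * ρ := by nlinarith
  -- Adding ρ² makes w positive even when p lies on the vertical axis.
  obtain ⟨s, hs, hs1, hs2⟩ := exists_mem_shellRadii (w := z + ρ ^ 2) (by positivity) (by linarith)
  have hs0 := pos_of_mem_shellRadii hs
  have hww : (z + ρ ^ 2) ^ 2 ≤ 4 * ρ ^ 2 := by nlinarith
  have hzs : |z - s| ≤ 4 * ρ ^ 2 := by rw [abs_le]; constructor <;> nlinarith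
  have hss : s ^ 2 ≤ 4 * ρ ^ 2 := by nlinarith
  -- Keep the height if it is already in the cusp, otherwise move it to 2s² ≤ 8ρ². The total move is
  -- at most 4ρ² + 16ρ² < lam·ρ, as ρ < lam/100.
  obtain ⟨t, ht, htp⟩ : ∃ t, 2 * s ^ 2 ≤ |t| ∧ |p 2 - t| ≤ 16 * ρ ^ 2 := by
    by_cases h : 2 * s ^ 2 ≤ |p 2|
    · exact ⟨p 2, h, by simp; positivity⟩
    · refine ⟨2 * s ^ 2, le_abs_self _, ?_⟩
      have := abs_lt.1 (not_le.1 h)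
      rw [abs_le]; constructor <;> linarith
  obtain ⟨a, b, hab, hpr⟩ := exists_eq_radialPoint p
  refine eq_empty_iff_forall_notMem.1 (hball n) (radialPoint a b s t) ⟨?_, mem_cuspShells.2 ?_⟩
  · simp only [mem_ofPred_eq]
    rw [edist_dist, edist_dist, dist_zero_right, ← ENNReal.ofReal_mul hl0.le]
    refine (ENNReal.ofReal_lt_ofReal_iff (by positivity)).2 ?_
    have h1 := dist_radialPoint_le hab z s (p 2) t
    rw [← hpr] at h1
    change dist p _ < lam * ρ
    nlinarith
  · rw [horNorm_radialPoint hab hs0.le]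
    exact ⟨ht, Or.inr hs⟩

/-- The points `0` and those with `|(x, y)| ∈ A_{n,k}`, for some `n ≥ 1` and `k < 2 ^ n`, which lie
outside the Euclidean cone `|t| > |(x, y)|`. -/
def coneShells : Set H1 := {p | |p 2| ≤ horNorm p ∧ (p = 0 ∨ horNorm p ∈ shellRadii)}

theorem isPorous_edist_coneShells : IsPorous (fun p q : H1 => edist p q) coneShells := by
  refine ⟨1 / 4, by norm_num, fun p hp => ?_⟩
  rcases hp.2 with rfl | hr
  · refine isPorousAtWith_zero_of_gap (fun r => radialPoint 1 0 0 r) (fun r hr h => ?_)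
      (fun r hr => ?_) (fun r hr y hy hyE => ?_)
    · exact hr.ne' (by simpa using congrArg (fun q : H1 => q 2) h)
    · have h0 : (0 : H1) = radialPoint 1 0 0 0 := by
        ext i; fin_cases i <;> simp [radialPoint]
      rw [h0, edist_dist]
      exact ENNReal.ofReal_le_ofReal
        (by simpa [abs_of_pos hr] using dist_radialPoint_le (a := 1) (b := 0) (by norm_num) 0 0 r 0)
    · obtain ⟨h1, h2⟩ := bounds_of_edist_lt hy
      rw [horNorm_radialPoint (by norm_num) le_rfl, sub_zero, abs_of_nonneg (horNorm_nonneg y)] at h1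
      rw [radialPoint_two] at h2
      linarith [hyE.1, (abs_lt.1 h2).1, le_abs_self (y 2)]
  · exact isPorousAtWith_of_horNorm_mem edist_radialPoint_le
      (fun h => (bounds_of_edist_lt h).1) (fun q hq => hq.2) hr

/-- The ball estimate is applied with centre p and with 0 as the other point, so |t| ≤ 2(|(x,y)| +
R)R. -/
theorem bounds_of_ccDist_zero_lt {p : H1} {R : ℝ} (h : ccDist p 0 < ENNReal.ofReal R) :
    horNorm p < R ∧ |p 2| ≤ 4 * R ^ 2 := by
  obtain ⟨h1, h2⟩ := bounds_of_ccDist_lt h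
  rw [horNorm_zero, zero_sub, abs_neg, abs_of_nonneg (horNorm_nonneg p)] at h1
  have h0 := horNorm_nonneg p
  rw [PiLp.zero_apply, zero_sub, abs_neg] at h2
  exact ⟨h1, h2.trans (by nlinarith)⟩

theorem eq_zero_of_ccDist_zero {p : H1} (h : ccDist p 0 = 0) : p = 0 := by
  have hb : ∀ R : ℝ, 0 < R → horNorm p < R ∧ |p 2| ≤ 4 * R ^ 2 := fun R hR =>
    bounds_of_ccDist_zero_lt (h ▸ ENNReal.ofReal_pos.2 hR)
  refine eq_zero_of_horNorm_eq_zero ?_ ?_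
  · exact le_antisymm (le_of_forall_pos_lt_add fun R hR => by simpa using (hb R hR).1)
      (horNorm_nonneg p)
  · by_contra h2
    have h0 : 0 < |p 2| := abs_pos.2 h2
    have h3 := (hb (√(|p 2| / 8)) (Real.sqrt_pos.2 (by positivity))).2
    rw [Real.sq_sqrt (by positivity)] at h3
    linarith

theorem not_isPorousAt_ccDist_coneShells : ¬ IsPorousAt ccDist coneShells 0 := by
  rintro ⟨lam, ⟨hl0, hl1⟩, x, hne, hlim, hball⟩
  obtain ⟨n, hn⟩ := (hlim.eventually_lt_const
    (ENNReal.ofReal_pos.2 (by linarith : 0 < lam / 100))).exists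
  set p := x n
  set δ := (ccDist p 0).toReal with hδ
  have hfin : ccDist p 0 ≠ ∞ := hn.ne_top
  have hδe : ccDist p 0 = ENNReal.ofReal δ := (ENNReal.ofReal_toReal hfin).symm
  have hδ0 : 0 < δ := ENNReal.toReal_pos (fun h => hne n (eq_zero_of_ccDist_zero h)) hfin
  rw [hδe, ENNReal.ofReal_lt_ofReal_iff (by linarith)] at hn
  obtain ⟨hz, ht⟩ := bounds_of_ccDist_zero_lt (p := p) (R := 2 * δ)
    (by rw [hδe]; exact (ENNReal.ofReal_lt_ofReal_iff (by linarith)).2 (by linarith))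
  set z := horNorm p
  have hz0 : 0 ≤ z := horNorm_nonneg p
  have hw2 : z + 25 * δ ^ 2 ≤ 3 * δ := by nlinarith
  -- With R = 2δ, |t| ≤ 16δ². As w² ≤ 9δ², the constant 25 = 16 + 9 gives s ≥ w - w² ≥ 16δ² ≥ |t|,
  -- which puts the new point in the cone region.
  obtain ⟨s, hs, hs1, hs2⟩ := exists_mem_shellRadii (w := z + 25 * δ ^ 2) (by positivity)
    (by linarith)
  have hww : (z + 25 * δ ^ 2) ^ 2 ≤ 9 * δ ^ 2 := by nlinarith
  have hs0 := pos_of_mem_shellRadii hs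
  have hzs : |z - s| ≤ 25 * δ ^ 2 := by rw [abs_le]; constructor <;> nlinarith
  obtain ⟨a, b, hab, hpr⟩ := exists_eq_radialPoint p
  refine eq_empty_iff_forall_notMem.1 (hball n) (radialPoint a b s (p 2)) ⟨?_, ?_, ?_⟩
  · have h1 := ccDist_radialPoint_le hab z s (p 2)
    rw [← hpr] at h1
    change ccDist p _ < ENNReal.ofReal lam * ccDist p 0
    rw [hδe, ← ENNReal.ofReal_mul hl0.le]
    refine h1.trans_lt ((ENNReal.ofReal_lt_ofReal_iff (by positivity)).2 ?_)
    nlinarith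
  · rw [horNorm_radialPoint hab hs0.le, radialPoint_two]
    nlinarith
  · rw [horNorm_radialPoint hab hs0.le]
    exact Or.inr hs

theorem zero_mem_cuspShells : (0 : H1) ∈ cuspShells := mem_cuspShells.2 ⟨by simp, Or.inl rfl⟩

theorem zero_mem_coneShells : (0 : H1) ∈ coneShells := ⟨by simp, Or.inl rfl⟩

end Heisenberg

/-- A porous set is porous at each of its points. -/
theorem IsPorous.isPorousAt {M : Type*} {d : M → M → ℝ≥0∞} {E : Set M} (h : IsPorous d E) {a : M}
    (ha : a ∈ E) : IsPorousAt d E a :=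
  let ⟨lam, hlam, hE⟩ := h
  ⟨lam, hlam, hE a ha⟩

open Heisenberg in
/-- Carnot-Carathéodory porosity and Euclidean porosity are incomparable in `ℍ¹`. -/
theorem mainTheorem5 :
    IsPorous Heisenberg.ccDist Heisenberg.cuspShells ∧
    ¬ IsPorousAt (fun p q : Heisenberg.H1 => edist p q) Heisenberg.cuspShells 0 ∧
    (∃ E : Set Heisenberg.H1,
      IsPorous Heisenberg.ccDist E ∧ ¬ IsPorous (fun p q : Heisenberg.H1 => edist p q) E) ∧
    (∃ E : Set Heisenberg.H1,
      IsPorous (fun p q : Heisenberg.H1 => edist p q) E ∧ ¬ IsPorous Heisenberg.ccDist E) :=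
  ⟨isPorous_ccDist_cuspShells, not_isPorousAt_edist_cuspShells,
    ⟨cuspShells, isPorous_ccDist_cuspShells,
      fun h => not_isPorousAt_edist_cuspShells (h.isPorousAt zero_mem_cuspShells)⟩,
    ⟨coneShells, isPorous_edist_coneShells,
      fun h => not_isPorousAt_ccDist_coneShells (h.isPorousAt zero_mem_coneShells)⟩⟩
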